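/- Modal formulas are built from variables $p_0,p_1,\dots$, $\bot$, $\to$ and $\Box$, with $\neg\varphi=\varphi\to\bot$ and $\Diamond\varphi=\neg\Box\neg\varphi$. A frame is a pair $F=(X,R)$ with $X\neq\varnothing$ and $R\subseteq X\times X$. Let $\mathbf{K5B}$ be the least normal modal logic containing $\Diamond p\to\Box\Diamond p$ and $p\to\Box\Diamond p$. A $\mathbf{K5B}$-frame is a frame in which every formula of $\mathbf{K5B}$ is valid. A connected component of $F$ is an equivalence class of $(R\cup R^{-1})^*$, considered with the restriction of $R$, and $F$ is connected if it has exactly one component. A frame is a cluster if $R=X\times X$, and an irreflexive singleton if $|X|=1$ and $R=\varnothing$. For $n\ge 1$ let $\hat F_n$ be uniformly distributed on the (finite, nonempty) set of $\mathbf{K5B}$-frames with set of states $[n]=\{0,\dots,n-1\}$. A property holds asymptotically almost surely (a.a.s.) if the probability that $\hat F_n$ has it tends to $1$ as $n\to\infty$. Let $\mathbf{K5B}^{\mathbf{as}}$ be the set of formulas that are a.a.s. valid in $\hat F_n$, and let $B_n$ denote the $n$-th Bell number. **Theorem 3.11** ($\mathbf{K5B}^{\mathbf{as}}=\mathbf{K5B}$).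 1. $\mathbf{K5B}^{\mathbf{as}}=\mathbf{K5B}$. 2. A frame is a connected $\mathbf{K5B}$-frame if and only if it is a cluster or an irreflexive singleton. 3. For every $n\ge1$ the number of $\mathbf{K5B}$-frames with set of states $[n]$ is $B_{n+1}$. 4. $B_n/B_{n+1}\to0$ as $n\to\infty$. 5. A.a.s. some connected component of $\hat F_n$ is an irreflexive singleton. 6. For every fixed $r\in\mathbb N$, a.a.s. some connected component of $\hat F_n$ is a cluster with more than $r$ states. -/

import Mathlib

open Filter Topology

universe u

/-- Formulas of the basic modal language over the variables `p₀, p₁, …`. -/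
inductive ModalFormula : Type
  | var : ℕ → ModalFormula
  | bot : ModalFormula
  | imp : ModalFormula → ModalFormula → ModalFormula
  | box : ModalFormula → ModalFormula

namespace ModalFormula

def neg (φ : ModalFormula) : ModalFormula := imp φ bot

def dia (φ : ModalFormula) : ModalFormula := neg (box (neg φ))

/-- `φ.subst p θ` replaces all instances of the variable `p` in `φ` by `θ`. -/
def subst (φ : ModalFormula) (p : ℕ) (θ : ModalFormula) : ModalFormula :=
  match φ with
  | var q => if q = p then θ else var q
  | bot => bot
  | imp ψ χ => imp (subst ψ p θ) (subst χ p θ)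
  | box ψ => box (subst ψ p θ)

/-- Propositional tautologies of the modal language: formulas true under every assignment of
truth values that respects `⊥` and `→` (variables and boxed formulas being treated as atoms). -/
def IsTautology (φ : ModalFormula) : Prop :=
  ∀ v : ModalFormula → Prop, ¬ v bot → (∀ ψ χ, v (imp ψ χ) ↔ (v ψ → v χ)) → v φ

/-- The normality axiom `□(p → q) → (□p → □q)`. -/
def axK : ModalFormula :=
  imp (box (imp (var 0) (var 1))) (imp (box (var 0)) (box (var 1)))

/-- The axiom `◇p → □◇p`. -/
def ax5 : ModalFormula := imp (dia (var 0)) (box (dia (var 0)))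

/-- The axiom `p → □◇p`. -/
def axB : ModalFormula := imp (var 0) (box (dia (var 0)))

end ModalFormula

/-- Normal modal logics. -/
structure IsNormalLogic (L : Set ModalFormula) : Prop where
  taut : ∀ φ : ModalFormula, φ.IsTautology → φ ∈ L
  normality : ModalFormula.axK ∈ L
  mp : ∀ φ ψ : ModalFormula, φ ∈ L → φ.imp ψ ∈ L → ψ ∈ L
  gen : ∀ φ : ModalFormula, φ ∈ L → φ.box ∈ L
  sub : ∀ (φ : ModalFormula) (p : ℕ) (θ : ModalFormula), φ ∈ L → φ.subst p θ ∈ L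

/-- The logic `K5B`: the least normal modal logic containing the axioms `5` and `B`. -/
def logicK5B : Set ModalFormula :=
  ⋂₀ {L | IsNormalLogic L ∧ ModalFormula.ax5 ∈ L ∧ ModalFormula.axB ∈ L}

/-- Kripke frames `(X, R)` with `X` nonempty. -/
structure KripkeFrame : Type (u + 1) where
  dom : Type u
  nonempty : Nonempty dom
  rel : dom → dom → Prop

namespace KripkeFrame

/-- Truth of a formula at a state of `F` under the valuation `V`. -/
def Sat (F : KripkeFrame.{u}) (V : ℕ → Set F.dom) : F.dom → ModalFormula → Prop
  | a, .var p => a ∈ V p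
  | _, .bot => False
  | a, .imp φ ψ => F.Sat V a φ → F.Sat V a ψ
  | a, .box φ => ∀ b, F.rel a b → F.Sat V b φ

/-- `F ⊨ φ`: truth at every state under every valuation. -/
def Valid (F : KripkeFrame.{u}) (φ : ModalFormula) : Prop :=
  ∀ (V : ℕ → Set F.dom) (a : F.dom), F.Sat V a φ

/-- The equivalence relation `(R ∪ R⁻¹)*`. -/
def Linked (F : KripkeFrame.{u}) : F.dom → F.dom → Prop :=
  Relation.ReflTransGen fun a b => F.rel a b ∨ F.rel b a

/-- The connected component of a state. -/
def component (F : KripkeFrame.{u}) (a : F.dom) : Set F.dom := {b | F.Linked a b}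

/-- `F` has exactly one connected component. -/
def Connected (F : KripkeFrame.{u}) : Prop := ∃! U : Set F.dom, ∃ a, U = F.component a

/-- The restriction of `F` to the connected component of `a`. -/
def componentFrame (F : KripkeFrame.{u}) (a : F.dom) : KripkeFrame.{u} where
  dom := F.component a
  nonempty := ⟨⟨a, Relation.ReflTransGen.refl⟩⟩
  rel b c := F.rel b.1 c.1

def IsCluster (F : KripkeFrame.{u}) : Prop := ∀ a b, F.rel a b

/-- `F` has exactly one state and empty relation. -/
def IsIrreflexiveSingleton (F : KripkeFrame.{u}) : Prop :=
  (∃ a : F.dom, ∀ b, b = a) ∧ ∀ a, ¬ F.rel a a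

/-- Some connected component of `F` is an irreflexive singleton. -/
def HasIrreflexiveSingleton (F : KripkeFrame.{u}) : Prop :=
  ∃ a, (F.componentFrame a).IsIrreflexiveSingleton

/-- Some connected component of `F` is a cluster with more than `r` states. -/
def HasClusterLargerThan (F : KripkeFrame.{u}) (r : ℕ) : Prop :=
  ∃ a, (F.componentFrame a).IsCluster ∧ (r : ℕ∞) < (F.component a).encard

/-- The set `𝓕ₙ` of all frames with set of states `[n] = {0, …, n - 1}`
(empty for `n = 0`, frames being nonempty). -/
def labelled (n : ℕ) : Set KripkeFrame.{0} :=
  {F | ∃ (h : Nonempty (Fin n)) (R : Fin n → Fin n → Prop), F = ⟨Fin n, h, R⟩}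

end KripkeFrame

/-- `Fr Γ`: the class of frames validating every formula of `Γ`. -/
def Fr (Γ : Set ModalFormula) : Set KripkeFrame.{u} := {F | ∀ φ ∈ Γ, F.Valid φ}

/-- The probability that the uniformly distributed random element of `𝓕ₙ ∩ C` lies in `Q`. -/
noncomputable def frameProb (C : Set KripkeFrame.{0}) (n : ℕ) (Q : Set KripkeFrame.{0}) : ℝ :=
  ((KripkeFrame.labelled n ∩ C ∩ Q).ncard : ℝ) / ((KripkeFrame.labelled n ∩ C).ncard : ℝ)

/-- The random `C`-frame on `[n]` has the property `Q` asymptotically almost surely. -/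
def HoldsAAS (C : Set KripkeFrame.{0}) (Q : Set KripkeFrame.{0}) : Prop :=
  Tendsto (fun n : ℕ => frameProb C n Q) atTop (𝓝 1)

/-- `Log^as C`: the formulas that are asymptotically almost surely valid in the random
`C`-frame. -/
def logAS (C : Set KripkeFrame.{0}) : Set ModalFormula := {φ | HoldsAAS C {F | F.Valid φ}}

/-- `L^as = Log^as (Fr L)`. -/
def almostSureLogic (L : Set ModalFormula) : Set ModalFormula := logAS (Fr L)

/-! The axioms 5 and B force exactly symmetry and transitivity (`mem_Fr_logicK5B_iff`), so a
`K5B`-frame is a disjoint union of clusters and irreflexive points. Sending the irreflexive points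
to the block of one extra element explains the count by partitions of `n + 1` elements; here the
count comes from a recursion on the class of one point (`card_perFinset`). Frames without
irreflexive points are equivalence relations, counted by `Nat.bell n`, and Dobiński's formula makes
their share vanish. Frames with classes of bounded size obey the same recursion truncated; each
truncation loses a fixed factor, so their share decays exponentially (`exists_boundedPERCount_le`).

For the logic, validity in all `K5B`-frames gives one inclusion. Conversely, the canonical frame
refutes any non-theorem at some state `a`. If `a` is irreflexive, every irreflexive singleton
refutes the formula. Otherwise `a` lies in a cluster, where only the types over the `k` variables of
the formula matter, so every cluster with more than `2 ^ k` states refutes it. Almost surely both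
kinds of component occur. -/

/-- Symmetric and transitive relations. -/
structure IsPER {α : Type*} (R : α → α → Prop) : Prop where
  symm : ∀ {a b}, R a b → R b a
  trans : ∀ {a b c}, R a b → R b c → R a c

theorem IsPER.refl_of_rel {α : Type*} {R : α → α → Prop} (h : IsPER R) {a b : α} (hab : R a b) :
    R a a :=
  h.trans hab (h.symm hab)

/-! ### Soundness and frame correspondence -/

namespace ModalFormula

/-- The variables of a formula. -/
def vars : ModalFormula → Finset ℕ
  | var p => {p}
  | bot => ∅
  | imp φ ψ => φ.vars ∪ ψ.vars
  | box φ => φ.vars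

theorem subst_eq_self {φ : ModalFormula} {p : ℕ} (h : p ∉ φ.vars) (θ : ModalFormula) :
    φ.subst p θ = φ := by
  induction φ with
  | var q => simp [vars] at h; simp [subst, Ne.symm h]
  | bot => rfl
  | imp φ ψ h₁ h₂ => simp [vars] at h; simp [subst, h₁ h.1, h₂ h.2]
  | box φ h₁ => simp [subst, h₁ h]

end ModalFormula

namespace KripkeFrame

variable {F : KripkeFrame.{u}}

theorem sat_dia {V : ℕ → Set F.dom} {a : F.dom} {φ : ModalFormula} :
    F.Sat V a φ.dia ↔ ∃ b, F.rel a b ∧ F.Sat V b φ := by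
  change ¬ (∀ b, F.rel a b → ¬ F.Sat V b φ) ↔ _
  push Not
  rfl

theorem sat_subst (V : ℕ → Set F.dom) (p : ℕ) (θ φ : ModalFormula) (a : F.dom) :
    F.Sat V a (φ.subst p θ) ↔ F.Sat (Function.update V p {b | F.Sat V b θ}) a φ := by
  induction φ generalizing a with
  | var q =>
    by_cases h : q = p
    · subst h; simp [ModalFormula.subst, Sat]
    · simp [ModalFormula.subst, Sat, h]
  | bot => rfl
  | imp φ ψ h₁ h₂ => simp only [ModalFormula.subst, Sat, h₁, h₂]
  | box φ h => simp only [ModalFormula.subst, Sat, h]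

theorem isNormalLogic_valid (F : KripkeFrame.{u}) : IsNormalLogic {φ | F.Valid φ} where
  taut _ h V a := h (F.Sat V a) id fun _ _ => Iff.rfl
  normality _ _ h₁ h₂ b hab := h₁ b hab (h₂ b hab)
  mp _ _ h₁ h₂ V a := h₂ V a (h₁ V a)
  gen _ h V _ b _ := h V b
  sub _ _ _ h V a := (sat_subst V _ _ _ a).2 (h _ a)

end KripkeFrame

theorem logicK5B_isNormalLogic : IsNormalLogic logicK5B where
  taut _ h _ hL := hL.1.taut _ h
  normality _ hL := hL.1.normality
  mp _ _ h₁ h₂ L hL := hL.1.mp _ _ (h₁ L hL) (h₂ L hL)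
  gen _ h L hL := hL.1.gen _ (h L hL)
  sub _ _ _ h L hL := hL.1.sub _ _ _ (h L hL)

theorem ax5_mem_logicK5B : ModalFormula.ax5 ∈ logicK5B := fun _ hL => hL.2.1

theorem axB_mem_logicK5B : ModalFormula.axB ∈ logicK5B := fun _ hL => hL.2.2

/-- The `K5B`-frames are those with a symmetric and transitive relation. -/
theorem mem_Fr_logicK5B_iff {F : KripkeFrame.{u}} : F ∈ Fr logicK5B ↔ IsPER F.rel := by
  constructor
  · intro h
    have hs : ∀ {a b}, F.rel a b → F.rel b a := by
      intro a b hab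
      -- Let the variable hold only at `a`: a witness of the diamond at `b` must be `a` itself.
      -- Transitivity below uses the singleton `{c}` in the same way.
      obtain ⟨c, hbc, hc⟩ := KripkeFrame.sat_dia.1
        (h _ axB_mem_logicK5B (fun _ => {a}) a rfl b hab)
      exact (show c = a from hc) ▸ hbc
    refine ⟨hs, fun {a b c} hab hbc => ?_⟩
    obtain ⟨d, had, hd⟩ := KripkeFrame.sat_dia.1
      (h _ ax5_mem_logicK5B (fun _ => {c}) b (KripkeFrame.sat_dia.2 ⟨c, hbc, rfl⟩) a (hs hab))
    exact (show d = c from hd) ▸ had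
  · intro h φ hφ
    refine hφ {φ | F.Valid φ} ⟨F.isNormalLogic_valid, ?_, ?_⟩
    · intro V a ha b hab
      obtain ⟨c, hac, hc⟩ := KripkeFrame.sat_dia.1 ha
      exact KripkeFrame.sat_dia.2 ⟨c, h.trans (h.symm hab) hac, hc⟩
    · intro V a ha b hab
      exact KripkeFrame.sat_dia.2 ⟨a, h.symm hab, ha⟩

/-! ### Completeness through the canonical frame -/

namespace IsNormalLogic

open ModalFormula

variable {L : Set ModalFormula}

/-- Substitution replaces one variable at a time, and `φ` may contain `var 1`. Parking the second
variable at a fresh `q` keeps the later substitution of `ψ` out of `φ`. -/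
theorem axK_instance (hL : IsNormalLogic L) (φ ψ : ModalFormula) :
    imp (box (imp φ ψ)) (imp (box φ) (box ψ)) ∈ L := by
  obtain ⟨q, hq⟩ := Infinite.exists_notMem_finset (φ.vars ∪ {0})
  simp only [Finset.mem_union, Finset.mem_singleton, not_or] at hq
  have h := hL.sub _ q ψ (hL.sub _ 0 φ (hL.sub _ 1 (var q) hL.normality))
  simpa [axK, subst, subst_eq_self hq.1, hq.2] using h

end IsNormalLogic

/-- Sets of formulas that contain `L` and are closed under modus ponens. -/
structure IsTheory (L T : Set ModalFormula) : Prop where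
  subset : L ⊆ T
  mp : ∀ φ ψ, φ ∈ T → φ.imp ψ ∈ T → ψ ∈ T

/-- Theories that are maximal among those omitting some formula. -/
structure IsMaximalTheory (L T : Set ModalFormula) : Prop extends IsTheory L T where
  exists_omitted : ∃ θ ∉ T, ∀ φ ∉ T, φ.imp θ ∈ T

section Theories

open ModalFormula

variable {L T : Set ModalFormula}

theorem IsTheory.adjoin (hL : IsNormalLogic L) (hT : IsTheory L T) (χ : ModalFormula) :
    IsTheory L {φ | χ.imp φ ∈ T} where
  subset φ hφ := hT.mp φ _ (hT.subset hφ) <| hT.subset <| hL.taut _ fun v _ hv => by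
    simp only [hv]; tauto
  mp φ ψ h₁ h₂ := hT.mp _ _ h₂ <| hT.mp _ _ h₁ <| hT.subset <| hL.taut _ fun v _ hv => by
    simp only [hv]; tauto

theorem IsTheory.exists_maximal (hL : IsNormalLogic L) (hT : IsTheory L T) {θ : ModalFormula}
    (hθ : θ ∉ T) : ∃ U, T ⊆ U ∧ IsMaximalTheory L U ∧ θ ∉ U := by
  obtain ⟨U, hTU, hU⟩ := zorn_subset_nonempty {U | IsTheory L U ∧ θ ∉ U} (by
    intro c hc hchain ⟨U₀, hU₀⟩
    refine ⟨⋃₀ c, ⟨⟨fun φ hφ => ⟨U₀, hU₀, (hc hU₀).1.subset hφ⟩, ?_⟩, ?_⟩,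
      fun U hU => Set.subset_sUnion_of_mem hU⟩
    · rintro φ ψ ⟨U, hU, hφ⟩ ⟨W, hW, hφψ⟩
      rcases hchain.total hU hW with h | h
      · exact ⟨W, hW, (hc hW).1.mp φ ψ (h hφ) hφψ⟩
      · exact ⟨U, hU, (hc hU).1.mp φ ψ hφ (h hφψ)⟩
    · rintro ⟨U, hU, h⟩
      exact (hc hU).2 h) T ⟨hT, hθ⟩
  refine ⟨U, hTU, ⟨hU.prop.1, θ, hU.prop.2, fun χ hχ => ?_⟩, hU.prop.2⟩
  -- If `χ → θ` were missing, adjoining `χ` would still omit `θ`; by maximality nothing is added, so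
  -- `χ` is already in `U`.
  by_contra hne
  have hle : U ⊆ {φ | χ.imp φ ∈ U} := fun φ hφ =>
    hU.prop.1.mp φ _ hφ <| hU.prop.1.subset <| hL.taut _ fun v _ hv => by
      simp only [hv]; tauto
  have hsub := hU.le_of_ge (y := {φ | χ.imp φ ∈ U}) ⟨hU.prop.1.adjoin hL χ, hne⟩ hle
  exact hχ (hsub (hU.prop.1.subset (hL.taut _ fun v _ hv => by simp only [hv]; tauto)))

theorem IsMaximalTheory.bot_notMem (hL : IsNormalLogic L) (hT : IsMaximalTheory L T) :
    bot ∉ T := by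
  intro h
  obtain ⟨θ, hθ, -⟩ := hT.exists_omitted
  exact hθ (hT.mp _ _ h (hT.subset (hL.taut _ fun v hb hv => by simp only [hv]; tauto)))

theorem IsMaximalTheory.imp_mem_iff (hL : IsNormalLogic L) (hT : IsMaximalTheory L T)
    {φ ψ : ModalFormula} : φ.imp ψ ∈ T ↔ (φ ∈ T → ψ ∈ T) := by
  refine ⟨fun h hφ => hT.mp _ _ hφ h, fun h => ?_⟩
  by_cases hφ : φ ∈ T
  · exact hT.mp _ _ (h hφ) (hT.subset (hL.taut _ fun v _ hv => by simp only [hv]; tauto))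
  · obtain ⟨θ, hθ, hmax⟩ := hT.exists_omitted
    -- Both `φ → θ` and `(φ → ψ) → θ` lie in `T`, and classically they entail the omitted `θ`.
    by_contra hne
    exact hθ (hT.mp _ _ (hmax _ hne) (hT.mp _ _ (hmax _ hφ)
      (hT.subset (hL.taut _ fun v _ hv => by simp only [hv]; tauto))))

theorem IsMaximalTheory.neg_mem_iff (hL : IsNormalLogic L) (hT : IsMaximalTheory L T)
    {φ : ModalFormula} : φ.neg ∈ T ↔ φ ∉ T := by
  rw [ModalFormula.neg, hT.imp_mem_iff hL]
  simp [hT.bot_notMem hL]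

theorem IsTheory.box_preimage (hL : IsNormalLogic L) (hT : IsTheory L T) :
    IsTheory L {φ | φ.box ∈ T} where
  subset φ hφ := hT.subset (hL.gen φ hφ)
  mp φ ψ h₁ h₂ := hT.mp _ _ h₁ (hT.mp _ _ h₂ (hT.subset (hL.axK_instance φ ψ)))

theorem IsMaximalTheory.dia_neg_mem_iff (hL : IsNormalLogic L) (hT : IsMaximalTheory L T)
    {φ : ModalFormula} : φ.neg.dia ∈ T ↔ φ.box ∉ T := by
  rw [dia, hT.neg_mem_iff hL, not_iff_not]
  have h := hT.toIsTheory.box_preimage hL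
  constructor
  · exact fun h' => h.mp _ _ h' (h.subset (hL.taut _ fun v hb hv => by
      simp only [ModalFormula.neg, hv]; tauto))
  · exact fun h' => h.mp _ _ h' (h.subset (hL.taut _ fun v hb hv => by
      simp only [ModalFormula.neg, hv]; tauto))

/-- The canonical frame of a logic that omits `φ`. -/
def canonicalFrame (L : Set ModalFormula) (h : Nonempty {T // IsMaximalTheory L T}) :
    KripkeFrame.{0} where
  dom := {T // IsMaximalTheory L T}
  nonempty := h
  rel S T := ∀ φ : ModalFormula, φ.box ∈ S.1 → φ ∈ T.1

theorem canonicalFrame_sat_iff (hL : IsNormalLogic L) (h : Nonempty {T // IsMaximalTheory L T})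
    (φ : ModalFormula) (T : (canonicalFrame L h).dom) :
    (canonicalFrame L h).Sat (fun p => {S | var p ∈ S.1}) T φ ↔ φ ∈ T.1 := by
  induction φ generalizing T with
  | var p => rfl
  | bot => exact ⟨False.elim, T.2.bot_notMem hL⟩
  | imp φ ψ h₁ h₂ =>
    rw [T.2.imp_mem_iff hL, ← h₁, ← h₂]
    rfl
  | box φ ih =>
    constructor
    · intro hs
      by_contra hφ
      obtain ⟨U, hTU, hU, hφU⟩ := (T.2.toIsTheory.box_preimage hL).exists_maximal hL hφ
      exact hφU ((ih ⟨U, hU⟩).1 (hs ⟨U, hU⟩ fun ψ hψ => hTU hψ))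
    · exact fun hφ U hTU => (ih U).2 (hTU φ hφ)

end Theories

/-- If `φ ∉ S`, then B puts `□◇¬φ` in `S`, so a successor contains `◇¬φ` and cannot contain `□φ`.
For transitivity, `◇¬φ` at the middle theory becomes `□◇¬φ` by 5 and returns to `S` by symmetry. -/
theorem canonicalFrame_isPER {L : Set ModalFormula} (hL : IsNormalLogic L)
    (h5 : ModalFormula.ax5 ∈ L) (hB : ModalFormula.axB ∈ L)
    (h : Nonempty {T // IsMaximalTheory L T}) : IsPER (canonicalFrame L h).rel := by
  have h5' : ∀ φ : ModalFormula, φ.dia.imp φ.dia.box ∈ L := fun φ => hL.sub _ 0 φ h5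
  have hB' : ∀ φ : ModalFormula, φ.imp φ.dia.box ∈ L := fun φ => hL.sub _ 0 φ hB
  have hs : ∀ {S T}, (canonicalFrame L h).rel S T → (canonicalFrame L h).rel T S := by
    intro S T hST φ hφ
    by_contra hne
    have h₁ := S.2.mp _ _ ((S.2.neg_mem_iff hL).2 hne) (S.2.subset (hB' φ.neg))
    exact (T.2.dia_neg_mem_iff hL).1 (hST _ h₁) hφ
  refine ⟨hs, fun {S T U} hST hTU φ hφ => ?_⟩
  by_contra hne
  have h₁ : φ.neg.dia ∈ T.1 := (T.2.dia_neg_mem_iff hL).2 fun h' => hne (hTU _ h')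
  exact (S.2.dia_neg_mem_iff hL).1 (hs hST _ (T.2.mp _ _ h₁ (T.2.subset (h5' φ.neg)))) hφ

theorem exists_isPER_not_valid {φ : ModalFormula} (hφ : φ ∉ logicK5B) :
    ∃ F : KripkeFrame.{0}, IsPER F.rel ∧ ¬ F.Valid φ := by
  have hL := logicK5B_isNormalLogic
  obtain ⟨U, -, hU, hφU⟩ := (IsTheory.mk subset_rfl hL.mp).exists_maximal hL hφ
  refine ⟨canonicalFrame logicK5B ⟨⟨U, hU⟩⟩,
    canonicalFrame_isPER hL ax5_mem_logicK5B axB_mem_logicK5B _, fun hv => hφU ?_⟩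
  exact (canonicalFrame_sat_iff hL _ φ ⟨U, hU⟩).1 (hv _ _)

/-! ### Bisimulations and refutation in components -/

namespace KripkeFrame

universe v

theorem sat_iff_of_bisimulation {F : KripkeFrame.{u}} {G : KripkeFrame.{v}} {V : ℕ → Set F.dom}
    {W : ℕ → Set G.dom} {Z : F.dom → G.dom → Prop} {φ : ModalFormula}
    (hvar : ∀ a b, Z a b → ∀ p ∈ φ.vars, (a ∈ V p ↔ b ∈ W p))
    (hforth : ∀ a b, Z a b → ∀ a', F.rel a a' → ∃ b', G.rel b b' ∧ Z a' b')
    (hback : ∀ a b, Z a b → ∀ b', G.rel b b' → ∃ a', F.rel a a' ∧ Z a' b')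
    {a : F.dom} {b : G.dom} (hab : Z a b) : F.Sat V a φ ↔ G.Sat W b φ := by
  induction φ generalizing a b with
  | var p => exact hvar a b hab p (by simp [ModalFormula.vars])
  | bot => rfl
  | imp φ ψ h₁ h₂ =>
    exact imp_congr
      (h₁ (fun a b h p hp => hvar a b h p (by simp [ModalFormula.vars, hp])) hab)
      (h₂ (fun a b h p hp => hvar a b h p (by simp [ModalFormula.vars, hp])) hab)
  | box φ ih =>
    constructor
    · intro h b' hb'
      obtain ⟨a', ha', hz⟩ := hback a b hab b' hb'
      exact (ih hvar hz).1 (h a' ha')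
    · intro h a' ha'
      obtain ⟨b', hb', hz⟩ := hforth a b hab a' ha'
      exact (ih hvar hz).2 (h b' hb')

theorem not_valid_of_hasIrreflexiveSingleton {F : KripkeFrame.{u}} {G : KripkeFrame.{v}}
    {V : ℕ → Set F.dom} {a : F.dom} {φ : ModalFormula} (ha : ∀ b, ¬ F.rel a b)
    (hφ : ¬ F.Sat V a φ) (hG : G.HasIrreflexiveSingleton) : ¬ G.Valid φ := by
  obtain ⟨c, ⟨x, hx⟩, hirr⟩ := hG
  have hc : ∀ b, ¬ G.rel c b := by
    intro b hcb
    have h₁ := hx ⟨c, Relation.ReflTransGen.refl⟩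
    have h₂ := hx ⟨b, Relation.ReflTransGen.single (Or.inl hcb)⟩
    have h₃ : c = b := congrArg Subtype.val (h₁.trans h₂.symm)
    exact hirr ⟨c, Relation.ReflTransGen.refl⟩ (show G.rel c c from h₃ ▸ hcb)
  intro hv
  refine hφ ((sat_iff_of_bisimulation (W := fun p => {_y | a ∈ V p})
    (Z := fun x y => x = a ∧ y = c) ?_ ?_ ?_ ⟨rfl, rfl⟩).2 (hv _ c))
  · rintro _ _ ⟨rfl, rfl⟩ p _
    rfl
  · rintro _ _ ⟨rfl, rfl⟩ b hb
    exact (ha b hb).elim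
  · rintro _ _ ⟨rfl, rfl⟩ b hb
    exact (hc b hb).elim

/-- The type `t b` is the set of variables of `φ` true at `b`. The large cluster has room for an
injective code `j` of all types; pulling the valuation back along a decoding `g` makes equality of
types a bisimulation. -/
theorem not_valid_of_hasClusterLargerThan {F : KripkeFrame.{u}} {G : KripkeFrame.{v}}
    {V : ℕ → Set F.dom} {a : F.dom} {φ : ModalFormula} (hF : IsPER F.rel) (ha : F.rel a a)
    (hφ : ¬ F.Sat V a φ) (hG : G.HasClusterLargerThan (2 ^ φ.vars.card)) : ¬ G.Valid φ := by
  classical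
  obtain ⟨c, hcl, hcard⟩ := hG
  let t : F.dom → Finset ℕ := fun b => φ.vars.filter fun p => b ∈ V p
  have ht : ∀ b, t b ∈ (φ.vars.powerset : Set (Finset ℕ)) := fun b =>
    Finset.mem_coe.2 (Finset.mem_powerset.2 (Finset.filter_subset _ _))
  have := G.nonempty
  obtain ⟨j, hj, hinj⟩ := (φ.vars.powerset.finite_toSet).exists_injOn_of_encard_le
    (t := G.component c) (by
      rw [Set.encard_coe_eq_coe_finsetCard, Finset.card_powerset]
      exact hcard.le)
  -- States `y` that code no type realised in the cluster of `a` may be decoded to any of its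
  -- states; `a` is the default.
  have hg : ∀ y, ∃ x, F.rel a x ∧ ∀ b, F.rel a b → j (t b) = y → t x = t b := by
    intro y
    by_cases h : ∃ b, F.rel a b ∧ j (t b) = y
    · obtain ⟨b, hb, rfl⟩ := h
      exact ⟨b, hb, fun b' _ h' => hinj (ht b) (ht b') h'.symm⟩
    · push Not at h
      exact ⟨a, ha, fun b hb h' => (h b hb h').elim⟩
  choose g hga hgt using hg
  have htv : ∀ {x y p}, t x = t y → p ∈ φ.vars → (x ∈ V p ↔ y ∈ V p) := by
    intro x y p h hp
    have := congrArg (p ∈ ·) h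
    simpa [t, hp] using this
  have hmem : ∀ b, j (t b) ∈ G.component c := fun b => hj (ht b)
  intro hv
  refine hφ ((sat_iff_of_bisimulation (W := fun p => {y | g y ∈ V p})
    (Z := fun x y => F.rel a x ∧ y ∈ G.component c ∧ t x = t (g y)) ?_ ?_ ?_
    (b := j (t a)) ⟨ha, hmem a, (hgt _ a ha rfl).symm⟩).2 (hv _ _))
  · rintro x y ⟨_, _, h⟩ p hp
    exact htv h hp
  · rintro x y ⟨hx, hy, h⟩ x' hx'
    have hax' := hF.trans hx hx'
    exact ⟨j (t x'), hcl ⟨y, hy⟩ ⟨_, hmem x'⟩, hax', hmem x', (hgt _ x' hax' rfl).symm⟩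
  · rintro x y ⟨hx, hy, h⟩ y' hy'
    exact ⟨g y', hF.trans (hF.symm hx) (hga y'), hga y',
      Relation.ReflTransGen.tail hy (Or.inl hy'), rfl⟩

/-! ### Components of `K5B`-frames -/

theorem component_eq_of_rel {F : KripkeFrame.{u}} (hF : IsPER F.rel) {a : F.dom}
    (ha : F.rel a a) : F.component a = {b | F.rel a b} := by
  ext b
  refine ⟨fun h => ?_, fun h => Relation.ReflTransGen.single (Or.inl h)⟩
  induction h with
  | refl => exact ha
  | tail _ h ih =>
    rcases h with h | h
    · exact hF.trans ih h
    · exact hF.trans ih (hF.symm h)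

theorem component_eq_of_not_rel {F : KripkeFrame.{u}} (hF : IsPER F.rel) {a : F.dom}
    (ha : ¬ F.rel a a) : F.component a = {a} := by
  ext b
  refine ⟨fun h => ?_, fun h => (show b = a from h) ▸ Relation.ReflTransGen.refl⟩
  induction h with
  | refl => rfl
  | tail _ h ih =>
    obtain rfl : _ = a := ih
    rcases h with h | h
    · exact (ha (hF.refl_of_rel h)).elim
    · exact (ha (hF.refl_of_rel (hF.symm h))).elim

theorem isCluster_componentFrame {F : KripkeFrame.{u}} (hF : IsPER F.rel) {a : F.dom}
    (ha : F.rel a a) : (F.componentFrame a).IsCluster := by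
  intro x y
  have h := component_eq_of_rel hF ha
  have hx : F.rel a x.1 := h.subset x.2
  have hy : F.rel a y.1 := h.subset y.2
  exact hF.trans (hF.symm hx) hy

theorem hasIrreflexiveSingleton_of_not_rel {F : KripkeFrame.{u}} (hF : IsPER F.rel) {a : F.dom}
    (ha : ¬ F.rel a a) : F.HasIrreflexiveSingleton := by
  have h : ∀ x : F.component a, x.1 = a := fun x =>
    (component_eq_of_not_rel hF ha).subset x.2
  refine ⟨a, ⟨⟨a, Relation.ReflTransGen.refl⟩, fun b => Subtype.ext (h b)⟩, fun b hb => ha ?_⟩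
  have hb' : F.rel b.1 b.1 := hb
  rwa [h b] at hb'

theorem connected_iff {F : KripkeFrame.{u}} : F.Connected ↔ ∀ a b, F.Linked a b := by
  constructor
  · rintro ⟨U, -, hU⟩ a b
    have h : F.component b = F.component a := (hU _ ⟨b, rfl⟩).trans (hU _ ⟨a, rfl⟩).symm
    exact h.subset (Relation.ReflTransGen.refl : F.Linked b b)
  · intro h
    obtain ⟨a⟩ := F.nonempty
    have huniv : ∀ c, F.component c = Set.univ := fun c => Set.eq_univ_of_forall (h c)
    refine ⟨Set.univ, ⟨a, (huniv a).symm⟩, ?_⟩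
    rintro _ ⟨c, rfl⟩
    exact huniv c

theorem mem_Fr_logicK5B_and_connected_iff (F : KripkeFrame.{u}) :
    (F ∈ Fr logicK5B ∧ F.Connected) ↔ (F.IsCluster ∨ F.IsIrreflexiveSingleton) := by
  rw [mem_Fr_logicK5B_iff, connected_iff]
  constructor
  · rintro ⟨hF, hc⟩
    obtain ⟨a⟩ := F.nonempty
    by_cases ha : F.rel a a
    · have h : ∀ b, F.rel a b := fun b => by
        have : b ∈ F.component a := hc a b
        rwa [component_eq_of_rel hF ha] at this
      exact Or.inl fun b c => hF.trans (hF.symm (h b)) (h c)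
    · have h : ∀ b, b = a := fun b => by
        have : b ∈ F.component a := hc a b
        rwa [component_eq_of_not_rel hF ha] at this
      exact Or.inr ⟨⟨a, h⟩, fun b => h b ▸ ha⟩
  · rintro (h | ⟨⟨a, ha⟩, hirr⟩)
    · exact ⟨⟨fun _ => h _ _, fun _ _ => h _ _⟩,
        fun a b => Relation.ReflTransGen.single (Or.inl (h a b))⟩
    · have hrel : ∀ b c, ¬ F.rel b c := fun b c hbc => hirr a (by rwa [ha b, ha c] at hbc)
      refine ⟨⟨fun h => (hrel _ _ h).elim, fun h => (hrel _ _ h).elim⟩, fun b c => ?_⟩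
      rw [ha b, ha c]
      exact Relation.ReflTransGen.refl

end KripkeFrame

/-! ### Growth of the Bell numbers -/

namespace Nat

open Nat

theorem bell_succ_eq_sum_range (n : ℕ) :
    Nat.bell (n + 1) = ∑ i ∈ Finset.range (n + 1), n.choose i * Nat.bell i := by
  rw [Nat.bell_succ', Finset.Nat.sum_antidiagonal_eq_sum_range_succ (fun x y => n.choose x * y.bell),
    ← Finset.sum_range_reflect]
  refine Finset.sum_congr rfl fun i hi => ?_
  have hi : i ≤ n := by simpa [Nat.lt_succ_iff] using hi
  rw [show n + 1 - 1 - i = n - i by omega, Nat.choose_symm hi, Nat.sub_sub_self hi]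

theorem bell_pos (n : ℕ) : 0 < Nat.bell n := by
  induction n using Nat.strong_induction_on with
  | _ n ih =>
    cases n with
    | zero => simp
    | succ n =>
      rw [bell_succ_eq_sum_range]
      exact Finset.sum_pos (fun i hi => Nat.mul_pos
        (Nat.choose_pos (by simpa [Nat.lt_succ_iff] using hi)) (ih i (by simpa using hi))) (by simp)

/-- Dobiński's formula. -/
theorem hasSum_pow_div_factorial_bell (n : ℕ) :
    HasSum (fun k : ℕ => (k : ℝ) ^ n / (k ! : ℝ)) (Nat.bell n * Real.exp 1) := by
  induction n using Nat.strong_induction_on with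
  | _ n ih =>
    cases n with
    | zero =>
      have h := NormedSpace.expSeries_div_hasSum_exp (1 : ℝ)
      rw [← Real.exp_eq_exp_ℝ] at h
      simpa using h
    | succ n =>
      -- The term at `k = 0` vanishes. After the shift, `(k + 1) ^ (n + 1) / (k + 1)! = (k + 1) ^ n
      -- / k !`, and the binomial theorem reproduces the Bell recursion.
      refine (hasSum_nat_add_iff' 1).1 ?_
      have h : HasSum (fun k : ℕ => ∑ i ∈ Finset.range (n + 1),
          (n.choose i : ℝ) * ((k : ℝ) ^ i / (k ! : ℝ)))
          (∑ i ∈ Finset.range (n + 1), (n.choose i : ℝ) * (Nat.bell i * Real.exp 1)) :=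
        hasSum_sum fun i hi => (ih i (by simpa using hi)).mul_left _
      have hterm : (fun k : ℕ => ((k + 1 : ℕ) : ℝ) ^ (n + 1) / ((k + 1)! : ℕ)) =
          fun k : ℕ => ∑ i ∈ Finset.range (n + 1),
            (n.choose i : ℝ) * ((k : ℝ) ^ i / (k ! : ℝ)) := by
        funext k
        have hk1 : ((k : ℝ) + 1) ≠ 0 := by positivity
        rw [Nat.factorial_succ]
        push_cast
        rw [_root_.pow_succ, mul_comm ((k : ℝ) + 1), mul_div_mul_right _ _ hk1, add_pow,
          Finset.sum_div]
        refine Finset.sum_congr rfl fun i _ => ?_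
        simp only [one_pow, mul_one]
        ring
      have hval : (Nat.bell (n + 1) : ℝ) * Real.exp 1 -
          ∑ i ∈ Finset.range 1, (i : ℝ) ^ (n + 1) / (i ! : ℝ) =
          ∑ i ∈ Finset.range (n + 1), (n.choose i : ℝ) * (Nat.bell i * Real.exp 1) := by
        rw [bell_succ_eq_sum_range]
        push_cast
        rw [Finset.sum_mul]
        simp [mul_assoc]
      rw [hterm, hval]
      exact h

/-- Termwise in Dobiński's series, `M * k ^ n ≤ k ^ (n + 1) + M ^ (n + 1)`: compare `k` with `M`. -/
theorem mul_bell_le_bell_succ_add_pow (M n : ℕ) :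
    (M : ℝ) * Nat.bell n ≤ Nat.bell (n + 1) + (M : ℝ) ^ (n + 1) := by
  have h₀ := hasSum_pow_div_factorial_bell 0
  have h₁ := ((hasSum_pow_div_factorial_bell n).mul_left (M : ℝ))
  have h₂ := (hasSum_pow_div_factorial_bell (n + 1)).add (h₀.mul_left ((M : ℝ) ^ (n + 1)))
  have h := hasSum_le (fun k => ?_) h₁ h₂
  · have he := Real.exp_pos 1
    simp only [Nat.bell_zero, Nat.cast_one, one_mul] at h
    refine le_of_mul_le_mul_right ?_ he
    linarith
  · rw [← mul_div_assoc, ← mul_div_assoc, ← add_div]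
    gcongr
    rcases le_total M k with hk | hk
    · have : (M : ℝ) ≤ k := by exact_mod_cast hk
      calc (M : ℝ) * (k : ℝ) ^ n ≤ k * (k : ℝ) ^ n := by gcongr
        _ = (k : ℝ) ^ (n + 1) := by ring
        _ ≤ _ := by simp
    · have : (k : ℝ) ≤ M := by exact_mod_cast hk
      calc (M : ℝ) * (k : ℝ) ^ n ≤ M * (M : ℝ) ^ n := by gcongr
        _ = (M : ℝ) ^ (n + 1) := by ring
        _ ≤ _ := by simp

theorem pow_div_factorial_le_bell (K n : ℕ) :
    (K : ℝ) ^ n / (K ! : ℝ) ≤ Nat.bell n * Real.exp 1 :=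
  le_hasSum (hasSum_pow_div_factorial_bell n) K fun _ _ => by positivity

theorem tendsto_pow_div_bell (M : ℕ) :
    Tendsto (fun n : ℕ => (M : ℝ) ^ n / (Nat.bell n : ℝ)) atTop (𝓝 0) := by
  have hlim : Tendsto (fun n : ℕ => ((M : ℝ) / (M + 1)) ^ n * (((M + 1)! : ℕ) * Real.exp 1))
      atTop (𝓝 0) := by
    rw [← zero_mul ((((M + 1)! : ℕ) : ℝ) * Real.exp 1)]
    refine (tendsto_pow_atTop_nhds_zero_of_lt_one (by positivity) ?_).mul_const _
    rw [div_lt_one (by positivity)]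
    linarith
  refine squeeze_zero (fun n => by positivity) (fun n => ?_) hlim
  -- The single Dobiński term at `M + 1` already outgrows `M ^ n`.
  have h := pow_div_factorial_le_bell (M + 1) n
  have hb : (0 : ℝ) < Nat.bell n := by exact_mod_cast bell_pos n
  push_cast at h
  rw [div_le_iff₀ (by positivity)] at h
  rw [div_le_iff₀ hb, div_pow]
  have hp : (0 : ℝ) < ((M : ℝ) + 1) ^ n := by positivity
  rw [div_mul_eq_mul_div, div_mul_eq_mul_div, le_div_iff₀ hp]
  have hM : (0 : ℝ) ≤ (M : ℝ) ^ n := by positivity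
  have := mul_le_mul_of_nonneg_left h hM
  linarith

theorem tendsto_bell_succ_div_bell :
    Tendsto (fun n : ℕ => (Nat.bell (n + 1) : ℝ) / (Nat.bell n : ℝ)) atTop atTop := by
  rw [tendsto_atTop]
  intro b
  obtain ⟨M, hM⟩ := exists_nat_ge (b + 1)
  have h := (tendsto_pow_div_bell M).const_mul (M : ℝ)
  rw [mul_zero] at h
  filter_upwards [h.eventually (gt_mem_nhds zero_lt_one)] with n hn
  have hb : (0 : ℝ) < Nat.bell n := by exact_mod_cast bell_pos n
  have h₁ := mul_bell_le_bell_succ_add_pow M n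
  rw [← mul_div_assoc, div_lt_one hb, ← _root_.pow_succ'] at hn
  rw [le_div_iff₀ hb]
  nlinarith

theorem tendsto_bell_div_bell_succ :
    Tendsto (fun n : ℕ => (Nat.bell n : ℝ) / (Nat.bell (n + 1) : ℝ)) atTop (𝓝 0) := by
  simpa [Function.comp_def] using tendsto_inv_atTop_zero.comp tendsto_bell_succ_div_bell

end Nat

/-! ### Counting symmetric transitive relations -/

section Counting

open Finset

open scoped Classical in
/-- The symmetric transitive relations with support in `D`, where the support is required to be
all of `D` unless `u` holds, and all classes have a cardinality satisfying `A`. -/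
noncomputable def perFinset {α : Type*} [Fintype α] (u : Prop) (A : ℕ → Prop) (D : Finset α) :
    Finset (α → α → Prop) :=
  univ.filter fun R => IsPER R ∧ (∀ x, R x x → x ∈ D) ∧ (u ∨ ∀ x ∈ D, R x x) ∧
    ∀ x, R x x → A (univ.filter (R x)).card

variable {α : Type*} [Fintype α] {u : Prop} {A : ℕ → Prop} {D : Finset α}

open scoped Classical in
theorem mem_perFinset {R : α → α → Prop} : R ∈ perFinset u A D ↔ IsPER R ∧
    (∀ x, R x x → x ∈ D) ∧ (u ∨ ∀ x ∈ D, R x x) ∧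
    ∀ x, R x x → A (univ.filter (R x)).card := by
  simp [perFinset]

theorem perFinset_empty : perFinset u A (∅ : Finset α) = {fun _ _ => False} := by
  ext R
  rw [mem_perFinset, mem_singleton]
  constructor
  · rintro ⟨hR, hs, -⟩
    funext x y
    exact eq_false fun h => notMem_empty x (hs x (hR.refl_of_rel h))
  · rintro rfl
    exact ⟨⟨id, fun h _ => h⟩, by simp, by simp, by simp⟩

open scoped Classical in
theorem filter_not_rel_perFinset_insert {a : α} (ha : a ∉ D) :
    (perFinset u A (insert a D)).filter (fun R => ¬ R a a) =
      if u then perFinset u A D else ∅ := by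
  split_ifs with hu
  · ext R
    simp only [mem_filter, mem_perFinset, hu, true_or, true_and]
    constructor
    · rintro ⟨⟨hR, hs, hA⟩, haa⟩
      refine ⟨hR, fun x hx => ?_, hA⟩
      rcases mem_insert.1 (hs x hx) with rfl | h
      · exact (haa hx).elim
      · exact h
    · rintro ⟨hR, hs, hA⟩
      exact ⟨⟨hR, fun x hx => mem_insert_of_mem (hs x hx), hA⟩, fun h => ha (hs a h)⟩
  · ext R
    simp [mem_perFinset, hu]
    tauto

-- Deleting the class `insert a S` leaves a relation on `D \ S`; restoring the full relation on that
-- class is the inverse.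
open scoped Classical in
theorem card_filter_class_eq_perFinset_insert {a : α} (ha : a ∉ D) {S : Finset α} (hS : S ⊆ D) :
    (((perFinset u A (insert a D)).filter (fun R => R a a)).filter
      (fun R => D.filter (R a) = S)).card =
      if A (S.card + 1) then (perFinset u A (D \ S)).card else 0 := by
  have haS : a ∉ S := fun h => ha (hS h)
  have key : ∀ {R : α → α → Prop}, R ∈ perFinset u A (insert a D) → R a a →
      D.filter (R a) = S → ∀ y, R a y ↔ y ∈ insert a S := by
    intro R hR haa hRS y
    rw [mem_perFinset] at hR
    rw [← hRS, mem_insert, mem_filter]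
    constructor
    · intro h
      rcases mem_insert.1 (hR.2.1 y (hR.1.refl_of_rel (hR.1.symm h))) with h' | h'
      · exact Or.inl h'
      · exact Or.inr ⟨h', h⟩
    · rintro (rfl | h)
      · exact haa
      · exact h.2
  split_ifs with hA
  · refine card_nbij' (fun R x y => R x y ∧ ¬ R a x)
      (fun R x y => R x y ∨ (x ∈ insert a S ∧ y ∈ insert a S)) ?_ ?_ ?_ ?_
    · intro R hR
      simp only [coe_filter, Set.mem_ofPred_eq, mem_filter] at hR
      obtain ⟨⟨hR, haa⟩, hRS⟩ := hR
      have hk := key hR haa hRS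
      rw [mem_perFinset] at hR
      obtain ⟨hP, hs, hu, hc⟩ := hR
      rw [mem_coe, mem_perFinset]
      refine ⟨⟨fun h => ⟨hP.symm h.1, fun h' => h.2 (hP.trans h' (hP.symm h.1))⟩,
        fun h h' => ⟨hP.trans h.1 h'.1, h.2⟩⟩, ?_, ?_, ?_⟩
      · rintro x ⟨hx, hax⟩
        have := hs x hx
        rw [hk] at hax
        grind
      · refine hu.imp_right fun hu x hx => ⟨hu x (by grind), ?_⟩
        rw [hk]
        grind
      · rintro x ⟨hx, hax⟩
        simpa [hax] using hc x hx
    · intro R hR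
      rw [mem_coe, mem_perFinset] at hR
      obtain ⟨hP, hs, hu, hc⟩ := hR
      have hl : ∀ {x y}, R x y → x ∉ insert a S := by
        intro x y h
        have := hs x (hP.refl_of_rel h)
        grind
      have hr : ∀ {x y}, R x y → y ∉ insert a S := fun h => hl (hP.symm h)
      simp only [coe_filter, Set.mem_ofPred_eq, mem_filter]
      refine ⟨⟨?_, Or.inr (by simp)⟩, ?_⟩
      · rw [mem_perFinset]
        refine ⟨⟨fun h => h.imp hP.symm And.symm, ?_⟩, ?_, ?_, ?_⟩
        · rintro x y z (h | h) (h' | h')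
          · exact Or.inl (hP.trans h h')
          · exact (hr h h'.1).elim
          · exact (hl h' h.2).elim
          · exact Or.inr ⟨h.1, h'.2⟩
        · rintro x (h | h)
          · have := hs x h
            grind
          · grind
        · refine hu.imp_right fun hu x hx => ?_
          by_cases hxS : x ∈ insert a S
          · exact Or.inr ⟨hxS, hxS⟩
          · exact Or.inl (hu x (by grind))
        · rintro x (h | h)
          · simpa [hl h] using hc x h
          · have he : univ.filter (fun y => R x y ∨ (x ∈ insert a S ∧ y ∈ insert a S)) =
                insert a S := by
              ext y
              simp only [mem_filter, mem_univ, true_and, h.1]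
              exact ⟨fun h' => h'.resolve_left fun h'' => hl h'' h.1, Or.inr⟩
            rw [← card_insert_of_notMem haS, ← he] at hA
            convert hA
      · ext y
        simp only [mem_filter, mem_insert_self, true_and]
        constructor
        · rintro ⟨hy, h | h⟩
          · exact (hl h (mem_insert_self _ _)).elim
          · grind
        · exact fun h => ⟨hS h, Or.inr (mem_insert_of_mem h)⟩
    · intro R hR
      simp only [coe_filter, Set.mem_ofPred_eq, mem_filter] at hR
      obtain ⟨⟨hR, haa⟩, hRS⟩ := hR
      have hk := key hR haa hRS
      have hP := (mem_perFinset.1 hR).1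
      funext x y
      simp only [eq_iff_iff, ← hk]
      constructor
      · rintro (h | h)
        · exact h.1
        · exact hP.trans (hP.symm h.1) h.2
      · intro h
        by_cases hx : R a x
        · exact Or.inr ⟨hx, hP.trans hx h⟩
        · exact Or.inl ⟨h, hx⟩
    · intro R hR
      rw [mem_coe, mem_perFinset] at hR
      obtain ⟨hP, hs, -, -⟩ := hR
      have hl : ∀ {x y}, R x y → x ∉ insert a S := by
        intro x y h
        have := hs x (hP.refl_of_rel h)
        grind
      funext x y
      simp only [eq_iff_iff, mem_insert_self, true_and]
      constructor
      · rintro ⟨h | h, h'⟩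
        · exact h
        · exact (h' (Or.inr h.1)).elim
      · intro h
        exact ⟨Or.inl h, fun h' => h'.elim (fun h' => hl h' (mem_insert_self _ _)) (hl h)⟩
  · rw [card_eq_zero, filter_eq_empty_iff]
    intro R hR hRS
    rw [mem_filter] at hR
    have hk := key hR.1 hR.2 hRS
    have := (mem_perFinset.1 hR.1).2.2.2 a hR.2
    refine hA ?_
    rw [← card_insert_of_notMem haS]
    convert this using 2
    ext y
    simp [hk]

open scoped Classical in
theorem card_perFinset_insert {a : α} (ha : a ∉ D) :
    (perFinset u A (insert a D)).card = (if u then (perFinset u A D).card else 0) +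
      ∑ S ∈ D.powerset, if A (S.card + 1) then (perFinset u A (D \ S)).card else 0 := by
  rw [← card_filter_add_card_filter_not (fun R : α → α → Prop => R a a), add_comm,
    filter_not_rel_perFinset_insert ha]
  congr 1
  · split_ifs <;> simp
  · rw [card_eq_sum_card_fiberwise (f := fun R => D.filter (R a)) (t := D.powerset)
      (fun R _ => mem_coe.2 (mem_powerset.2 (filter_subset _ _)))]
    exact sum_congr rfl fun S hS => card_filter_class_eq_perFinset_insert ha (mem_powerset.1 hS)

-- One recursion serves three counts: all relations, those reflexive on `D`, and those with bounded
-- classes.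
open scoped Classical in
theorem card_perFinset {f : ℕ → ℕ} (h₀ : f 0 = 1)
    (hf : ∀ n, f (n + 1) = (if u then f n else 0) +
      ∑ i ∈ range (n + 1), if A (i + 1) then n.choose i * f (n - i) else 0) (D : Finset α) :
    (perFinset u A D).card = f D.card := by
  induction hn : D.card using Nat.strong_induction_on generalizing D with
  | _ n ih =>
    rcases D.eq_empty_or_nonempty with rfl | ⟨a, ha⟩
    · rw [← hn, perFinset_empty, card_singleton, card_empty, h₀]
    · obtain ⟨E, haE, rfl⟩ : ∃ E, a ∉ E ∧ D = insert a E :=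
        ⟨D.erase a, by simp, (insert_erase ha).symm⟩
      rw [card_insert_of_notMem haE] at hn
      subst hn
      rw [card_perFinset_insert haE, hf, ih E.card (by omega) E rfl]
      congr 1
      calc _ = ∑ S ∈ E.powerset, if A (S.card + 1) then f (E.card - S.card) else 0 := by
            refine sum_congr rfl fun S hS => ?_
            have h := card_sdiff_of_subset (mem_powerset.1 hS)
            rw [ih _ (by omega) (E \ S) h]
        _ = _ := by
            rw [sum_powerset_apply_card (fun i => if A (i + 1) then f (E.card - i) else 0)]
            exact sum_congr rfl fun i _ => by split_ifs <;> simp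

/-- Pascal's rule splits the Bell recursion: the `n.choose (i + 1)` half and the term at index 0
reassemble `Nat.bell (n + 1)`. -/
theorem Nat.bell_add_two (n : ℕ) : Nat.bell (n + 2) = Nat.bell (n + 1) +
    ∑ i ∈ range (n + 1), n.choose i * Nat.bell (n - i + 1) := by
  rw [Nat.bell_succ_eq_sum_range (n + 1), sum_range_succ']
  have h : ∀ i, (n + 1).choose (i + 1) * Nat.bell (i + 1) =
      n.choose i * Nat.bell (i + 1) + n.choose (i + 1) * Nat.bell (i + 1) := fun i => by
    rw [Nat.choose_succ_succ, add_mul]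
  simp only [h, sum_add_distrib]
  have h₁ : ∑ i ∈ range (n + 1), n.choose i * Nat.bell (n - i + 1) =
      ∑ i ∈ range (n + 1), n.choose i * Nat.bell (i + 1) := by
    rw [← sum_range_reflect]
    refine sum_congr rfl fun i hi => ?_
    have hi : i ≤ n := by simpa [Nat.lt_succ_iff] using hi
    rw [show n + 1 - 1 - i = n - i by omega, Nat.choose_symm hi, Nat.sub_sub_self hi]
  have h₂ : Nat.bell (n + 1) =
      ∑ i ∈ range (n + 1), n.choose (i + 1) * Nat.bell (i + 1) + 1 := by
    rw [sum_range_succ, Nat.choose_succ_self, zero_mul, add_zero, Nat.bell_succ_eq_sum_range,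
      sum_range_succ']
    simp
  rw [h₁, h₂]
  simp
  ring

theorem card_perFinset_true (D : Finset α) :
    (perFinset True (fun _ => True) D).card = Nat.bell (D.card + 1) :=
  card_perFinset (f := fun n => Nat.bell (n + 1)) (by simp)
    (fun n => by simpa using Nat.bell_add_two n) D

theorem card_perFinset_false (D : Finset α) :
    (perFinset False (fun _ => True) D).card = Nat.bell D.card :=
  card_perFinset (by simp) (fun n => by
    simp [Nat.bell_succ, Nat.range_succ_eq_Iic]) D

/-! ### Relations with classes of bounded size -/

/-- The number of symmetric transitive relations on `n` points all of whose classes have at most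
`r + 1` elements. -/
def boundedPERCount (r : ℕ) : ℕ → ℕ
  | 0 => 1
  | n + 1 => boundedPERCount r n +
      ∑ i ∈ range (n + 1), if i ≤ r then n.choose i * boundedPERCount r (n - i) else 0

theorem card_perFinset_bounded (r : ℕ) (D : Finset α) :
    (perFinset True (fun k => k ≤ r + 1) D).card = boundedPERCount r D.card :=
  card_perFinset (by simp [boundedPERCount]) (fun n => by
    rw [boundedPERCount]
    simp) D

theorem boundedPERCount_le (r n : ℕ) : boundedPERCount r n ≤ Nat.bell (n + 1) := by
  rw [← card_fin n, ← card_perFinset_bounded, ← card_perFinset_true]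
  refine card_le_card fun R hR => ?_
  rw [mem_perFinset] at hR ⊢
  exact ⟨hR.1, hR.2.1, hR.2.2.1, fun _ _ => trivial⟩

/-- Combinatorially, a new element forms its own block or joins one of at most `n` blocks. The proof
compares binomial coefficients in the recursion. -/
theorem Nat.bell_succ_le (n : ℕ) : Nat.bell (n + 1) ≤ (n + 1) * Nat.bell n := by
  cases n with
  | zero => simp
  | succ n =>
    rw [Nat.bell_succ_eq_sum_range (n + 1), sum_range_succ]
    have h : ∑ i ∈ range (n + 1), (n + 1).choose i * Nat.bell i ≤
        (n + 1) * Nat.bell (n + 1) := by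
      rw [Nat.bell_succ_eq_sum_range n, mul_sum]
      refine sum_le_sum fun i hi => ?_
      rw [← mul_assoc]
      refine Nat.mul_le_mul_right _ ?_
      have hi : i ≤ n := by simpa [Nat.lt_succ_iff] using hi
      have h := Nat.choose_mul_succ_eq n i
      have h' : 1 ≤ n + 1 - i := by omega
      calc (n + 1).choose i ≤ (n + 1).choose i * (n + 1 - i) := Nat.le_mul_of_pos_right _ h'
        _ = (n + 1) * n.choose i := by rw [← h, mul_comm]
    simp only [Nat.choose_self, one_mul]
    linarith

theorem choose_mul_bell_le {n i : ℕ} (hi : i < n) : n.choose i * Nat.bell (n - i + 1) ≤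
    2 * (i + 1) * (n.choose (i + 1) * Nat.bell (n - (i + 1) + 1)) := by
  obtain ⟨k, rfl⟩ : ∃ k, n = i + 1 + k := ⟨n - (i + 1), by omega⟩
  have h₁ := Nat.bell_succ_le (k + 1)
  have h₂ := Nat.choose_succ_right_eq (i + 1 + k) i
  rw [show i + 1 + k - i = k + 1 by omega] at h₂ ⊢
  rw [show i + 1 + k - (i + 1) = k by omega]
  calc _ ≤ (i + 1 + k).choose i * ((k + 1 + 1) * Nat.bell (k + 1)) :=
        Nat.mul_le_mul_left _ h₁
    _ ≤ (i + 1 + k).choose i * ((2 * (k + 1)) * Nat.bell (k + 1)) := by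
        gcongr; omega
    _ = 2 * ((i + 1 + k).choose i * (k + 1)) * Nat.bell (k + 1) := by ring
    _ = _ := by rw [← h₂]; ring

theorem choose_mul_bell_le_pow {n r i : ℕ} (hr : r + 1 ≤ n) (hi : i ≤ r + 1) :
    n.choose i * Nat.bell (n - i + 1) ≤
      (2 * (r + 1)) ^ (r + 1 - i) * (n.choose (r + 1) * Nat.bell (n - (r + 1) + 1)) := by
  induction hi using Nat.decreasingInduction with
  | self => simp
  | of_succ i hi ih =>
    calc _ ≤ 2 * (i + 1) * (n.choose (i + 1) * Nat.bell (n - (i + 1) + 1)) :=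
          choose_mul_bell_le (by omega)
      _ ≤ 2 * (r + 1) * ((2 * (r + 1)) ^ (r + 1 - (i + 1)) *
          (n.choose (r + 1) * Nat.bell (n - (r + 1) + 1))) := by
          gcongr; omega
      _ = _ := by
          rw [← mul_assoc, ← pow_succ', show r + 1 - (i + 1) + 1 = r + 1 - i by omega]

theorem exists_bell_sum_le (r : ℕ) : ∃ c : ℕ, 0 < c ∧ ∀ n, r + 1 ≤ n →
    (c + 1) * (Nat.bell (n + 1) + ∑ i ∈ range (r + 1), n.choose i * Nat.bell (n - i + 1)) ≤
      c * Nat.bell (n + 2) := by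
  set K := (2 * (r + 1)) ^ (r + 1) with hK
  -- The truncated sum has `r + 2` terms (`t 0` occurs twice), each at most `K` times the first
  -- discarded term `t (r + 1)`.
  refine ⟨(r + 2) * K, by positivity, fun n hn => ?_⟩
  set t : ℕ → ℕ := fun i => n.choose i * Nat.bell (n - i + 1) with ht
  have hle : ∀ i ≤ r + 1, t i ≤ K * t (r + 1) := by
    intro i hi
    refine (choose_mul_bell_le_pow hn hi).trans (Nat.mul_le_mul_right _ ?_)
    exact Nat.pow_le_pow_right (by omega) (by omega)
  have h₀ : Nat.bell (n + 1) = t 0 := by simp [ht]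
  have hsum : ∑ i ∈ range (r + 1), t i ≤ (r + 1) * (K * t (r + 1)) := by
    simpa using sum_le_card_nsmul (range (r + 1)) t _ fun i hi =>
      hle i (le_of_lt (by simpa using hi))
  have hbig : t 0 + (∑ i ∈ range (r + 1), t i + t (r + 1)) ≤ Nat.bell (n + 2) := by
    rw [Nat.bell_add_two, h₀, ← sum_range_succ]
    gcongr
  rw [h₀]
  change _ * (t 0 + ∑ i ∈ range (r + 1), t i) ≤ _
  have hK0 := hle 0 (by omega)
  calc _ = (r + 2) * K * (t 0 + ∑ i ∈ range (r + 1), t i) + (t 0 + ∑ i ∈ range (r + 1), t i) := by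
        ring
    _ ≤ (r + 2) * K * (t 0 + ∑ i ∈ range (r + 1), t i) + (r + 2) * K * t (r + 1) := by
        gcongr; linarith
    _ = (r + 2) * K * (t 0 + (∑ i ∈ range (r + 1), t i + t (r + 1))) := by ring
    _ ≤ _ := by gcongr

theorem exists_boundedPERCount_le (r : ℕ) : ∃ C ρ : ℝ, 0 ≤ ρ ∧ ρ < 1 ∧
    ∀ n, (boundedPERCount r n : ℝ) ≤ C * ρ ^ n * Nat.bell (n + 1) := by
  obtain ⟨c, hc, hbell⟩ := exists_bell_sum_le r
  have hc' : (0 : ℝ) < c := by exact_mod_cast hc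
  set x : ℝ := c / (c + 1) with hx
  have hx0 : 0 < x := by positivity
  have hx1 : x < 1 := by rw [hx, div_lt_one (by positivity)]; linarith
  -- The recursion reaches back at most `r + 1` steps and gains a factor `x`, hence an `(r + 1)`-st
  -- root per step. The prefactor `(ρ ^ (r + 1))⁻¹` makes the trivial bound enough for `n ≤ r + 1`.
  set ρ : ℝ := x ^ (((r + 1 : ℕ) : ℝ)⁻¹) with hρ
  have hρ0 : 0 < ρ := Real.rpow_pos_of_pos hx0 _
  have hρ1 : ρ < 1 := Real.rpow_lt_one hx0.le hx1 (by positivity)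
  have hρx : ρ ^ (r + 1) = x := Real.rpow_inv_natCast_pow hx0.le (by omega)
  refine ⟨(ρ ^ (r + 1))⁻¹, ρ, hρ0.le, hρ1, fun n => ?_⟩
  induction n using Nat.strong_induction_on with
  | _ n ih =>
    rcases le_or_gt n (r + 1) with hn | hn
    · have h₁ : (boundedPERCount r n : ℝ) ≤ Nat.bell (n + 1) := by
        exact_mod_cast boundedPERCount_le r n
      have h₂ : 1 ≤ (ρ ^ (r + 1))⁻¹ * ρ ^ n := by
        rw [inv_mul_eq_div, one_le_div (by positivity)]
        exact pow_le_pow_of_le_one hρ0.le hρ1.le hn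
      calc _ ≤ (1 : ℝ) * Nat.bell (n + 1) := by rwa [one_mul]
        _ ≤ _ := by gcongr
    · obtain ⟨m, rfl⟩ : ∃ m, n = m + 1 := ⟨n - 1, by omega⟩
      have hm : r + 1 ≤ m := by omega
      set C : ℝ := (ρ ^ (r + 1))⁻¹ with hC
      have hC0 : 0 ≤ C := by positivity
      have hrec : boundedPERCount r (m + 1) = boundedPERCount r m +
          ∑ i ∈ range (r + 1), m.choose i * boundedPERCount r (m - i) := by
        rw [boundedPERCount, ← sum_filter]
        congr 2
        ext i
        simp only [mem_filter, mem_range]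
        omega
      have hterm : ∀ i ≤ r, (boundedPERCount r (m - i) : ℝ) ≤
          C * ρ ^ (m - r) * Nat.bell (m - i + 1) := by
        intro i hi
        refine (ih (m - i) (by omega)).trans ?_
        gcongr ?_ * ?_ * ?_
        exact pow_le_pow_of_le_one hρ0.le hρ1.le (by omega)
      have hW : ((c : ℝ) + 1) * (Nat.bell (m + 1) +
          ∑ i ∈ range (r + 1), (m.choose i : ℝ) * Nat.bell (m - i + 1)) ≤
            c * Nat.bell (m + 2) := by
        exact_mod_cast hbell m hm
      rw [hrec]
      push_cast
      calc _ ≤ C * ρ ^ (m - r) * Nat.bell (m + 1) + ∑ i ∈ range (r + 1),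
            (m.choose i : ℝ) * (C * ρ ^ (m - r) * Nat.bell (m - i + 1)) := by
            gcongr with i hi
            · exact hterm 0 (by omega)
            · exact hterm i (by simpa [Nat.lt_succ_iff] using hi)
        _ = C * ρ ^ (m - r) * (Nat.bell (m + 1) +
            ∑ i ∈ range (r + 1), (m.choose i : ℝ) * Nat.bell (m - i + 1)) := by
            rw [mul_add, mul_sum]
            congr 1
            exact sum_congr rfl fun i _ => by ring
        _ ≤ C * ρ ^ (m - r) * (ρ ^ (r + 1) * Nat.bell (m + 2)) := by
            gcongr
            rw [hρx, hx, div_mul_eq_mul_div, le_div_iff₀ (by positivity)]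
            linarith
        _ = _ := by
            rw [← mul_assoc, mul_assoc C, ← pow_add, show m - r + (r + 1) = m + 1 by omega]

theorem tendsto_boundedPERCount_div_bell (r : ℕ) :
    Tendsto (fun n : ℕ => (boundedPERCount r n : ℝ) / (Nat.bell (n + 1) : ℝ)) atTop (𝓝 0) := by
  obtain ⟨C, ρ, hρ0, hρ1, h⟩ := exists_boundedPERCount_le r
  have hlim : Tendsto (fun n : ℕ => C * ρ ^ n) atTop (𝓝 0) := by
    simpa using (tendsto_pow_atTop_nhds_zero_of_lt_one hρ0 hρ1).const_mul C
  refine squeeze_zero (fun n => by positivity) (fun n => ?_) hlim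
  have hb : (0 : ℝ) < Nat.bell (n + 1) := by exact_mod_cast Nat.bell_pos (n + 1)
  rw [div_le_iff₀ hb]
  exact h n

end Counting

/-! ### The random `K5B`-frame -/

namespace KripkeFrame

theorem labelled_inter_Fr_eq_image {n : ℕ} (hn : Nonempty (Fin n)) (Q : Set KripkeFrame.{0}) :
    labelled n ∩ Fr logicK5B ∩ Q = (fun R : Fin n → Fin n → Prop => KripkeFrame.mk (Fin n) hn R) ''
      {R | IsPER R ∧ KripkeFrame.mk (Fin n) hn R ∈ Q} := by
  ext F
  constructor
  · rintro ⟨⟨⟨h, R, rfl⟩, hF⟩, hQ⟩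
    exact ⟨R, ⟨mem_Fr_logicK5B_iff.1 hF, hQ⟩, rfl⟩
  · rintro ⟨R, ⟨hR, hQ⟩, rfl⟩
    exact ⟨⟨⟨hn, R, rfl⟩, mem_Fr_logicK5B_iff.2 hR⟩, hQ⟩

theorem ncard_labelled_inter_Fr {n : ℕ} (hn : Nonempty (Fin n)) (Q : Set KripkeFrame.{0}) :
    (labelled n ∩ Fr logicK5B ∩ Q).ncard =
      {R : Fin n → Fin n → Prop | IsPER R ∧ KripkeFrame.mk (Fin n) hn R ∈ Q}.ncard := by
  rw [labelled_inter_Fr_eq_image hn]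
  refine Set.ncard_image_of_injective _ fun R S h => ?_
  simpa using h

theorem ncard_labelled_inter_Fr_logicK5B {n : ℕ} (hn : 1 ≤ n) :
    (labelled n ∩ Fr logicK5B).ncard = Nat.bell (n + 1) := by
  have h := ncard_labelled_inter_Fr ⟨⟨0, hn⟩⟩ Set.univ
  rw [Set.inter_univ] at h
  have h' := card_perFinset_true (Finset.univ : Finset (Fin n))
  rw [Finset.card_fin] at h'
  rw [h, ← h', ← Set.ncard_coe_finset]
  congr 1
  ext R
  simp [mem_perFinset]

theorem ncard_labelled_inter_Fr_le {u : Prop} {A : ℕ → Prop} {Q : Set KripkeFrame.{0}} {n : ℕ}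
    (hn : 1 ≤ n) (hQ : ∀ (h : Nonempty (Fin n)) (R : Fin n → Fin n → Prop), IsPER R →
      KripkeFrame.mk (Fin n) h R ∈ Q → R ∈ perFinset u A Finset.univ) :
    (labelled n ∩ Fr logicK5B ∩ Q).ncard ≤
      (perFinset u A (Finset.univ : Finset (Fin n))).card := by
  rw [ncard_labelled_inter_Fr ⟨⟨0, hn⟩⟩, ← Set.ncard_coe_finset]
  exact Set.ncard_le_ncard (fun R hR => hQ _ R hR.1 hR.2) (Finset.finite_toSet _)

theorem finite_labelled_inter_Fr {n : ℕ} (hn : 1 ≤ n) :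
    (labelled n ∩ Fr logicK5B).Finite :=
  Set.finite_of_ncard_pos (by rw [ncard_labelled_inter_Fr_logicK5B hn]; exact Nat.bell_pos _)

end KripkeFrame

/-! ### Almost sure properties and the almost sure logic -/

open KripkeFrame

theorem frameProb_add_frameProb_compl {n : ℕ} (hn : 1 ≤ n) (Q : Set KripkeFrame.{0}) :
    frameProb (Fr logicK5B) n Q + frameProb (Fr logicK5B) n Qᶜ = 1 := by
  have hfin := finite_labelled_inter_Fr hn
  have h := Set.ncard_inter_add_ncard_sdiff_eq_ncard (labelled n ∩ Fr logicK5B) Q hfin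
  have hpos : (0 : ℝ) < ((labelled n ∩ Fr logicK5B).ncard : ℝ) := by
    rw [ncard_labelled_inter_Fr_logicK5B hn]
    exact_mod_cast Nat.bell_pos _
  rw [frameProb, frameProb, ← add_div, div_eq_one_iff_eq hpos.ne', ← Set.sdiff_eq]
  exact_mod_cast h

theorem frameProb_mono {n : ℕ} (hn : 1 ≤ n) {P Q : Set KripkeFrame.{0}} (h : P ⊆ Q) :
    frameProb (Fr logicK5B) n P ≤ frameProb (Fr logicK5B) n Q := by
  unfold frameProb
  gcongr
  exact (finite_labelled_inter_Fr hn).subset Set.inter_subset_left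

theorem holdsAAS_of_compl {Q : Set KripkeFrame.{0}}
    (h : Tendsto (fun n => frameProb (Fr logicK5B) n Qᶜ) atTop (𝓝 0)) :
    HoldsAAS (Fr logicK5B) Q := by
  have h' := h.const_sub 1
  rw [sub_zero] at h'
  refine h'.congr' ?_
  filter_upwards [eventually_ge_atTop 1] with n hn
  linarith [frameProb_add_frameProb_compl hn Q]

theorem not_holdsAAS_of_subset_compl {P Q : Set KripkeFrame.{0}} (hP : HoldsAAS (Fr logicK5B) P)
    (h : P ⊆ Qᶜ) : ¬ HoldsAAS (Fr logicK5B) Q := by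
  intro hQ
  have h₁ := hP.add hQ
  have h₂ : (1 : ℝ) + 1 ≤ 1 := by
    refine le_of_tendsto h₁ ?_
    filter_upwards [eventually_ge_atTop 1] with n hn
    linarith [frameProb_add_frameProb_compl hn Q, frameProb_mono hn h]
  norm_num at h₂

theorem holdsAAS_of_perFinset {u : Prop} {A : ℕ → Prop} {Q : Set KripkeFrame.{0}} {b : ℕ → ℕ}
    (hQ : ∀ {n : ℕ} (h : Nonempty (Fin n)) (R : Fin n → Fin n → Prop), IsPER R →
      KripkeFrame.mk (Fin n) h R ∉ Q → R ∈ perFinset u A Finset.univ)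
    (hb : ∀ n, (perFinset u A (Finset.univ : Finset (Fin n))).card = b n)
    (hlim : Tendsto (fun n : ℕ => (b n : ℝ) / (Nat.bell (n + 1) : ℝ)) atTop (𝓝 0)) :
    HoldsAAS (Fr logicK5B) Q := by
  refine holdsAAS_of_compl (squeeze_zero' (Eventually.of_forall fun n => ?_) ?_ hlim)
  · unfold frameProb
    positivity
  · filter_upwards [eventually_ge_atTop 1] with n hn
    rw [frameProb, ncard_labelled_inter_Fr_logicK5B hn, ← hb]
    gcongr
    exact ncard_labelled_inter_Fr_le hn fun h R hR hRQ => hQ h R hR hRQ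

theorem holdsAAS_hasIrreflexiveSingleton :
    HoldsAAS (Fr logicK5B) {F | F.HasIrreflexiveSingleton} := by
  refine holdsAAS_of_perFinset (u := False) (A := fun _ => True) ?_
    (fun n => by rw [card_perFinset_false, Finset.card_fin]) Nat.tendsto_bell_div_bell_succ
  intro n h R hR hQ
  rw [mem_perFinset]
  refine ⟨hR, by simp, Or.inr fun x _ => ?_, by simp⟩
  by_contra hx
  exact hQ (hasIrreflexiveSingleton_of_not_rel (F := ⟨Fin n, h, R⟩) hR hx)

theorem holdsAAS_hasClusterLargerThan (r : ℕ) :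
    HoldsAAS (Fr logicK5B) {F | F.HasClusterLargerThan r} := by
  classical
  -- Classes of size at most `r` would suffice; the bound `r + 1` matches `boundedPERCount r`, where
  -- `r` counts the other members of a class.
  refine holdsAAS_of_perFinset (u := True) (A := fun k => k ≤ r + 1) ?_
    (fun n => by rw [card_perFinset_bounded, Finset.card_fin])
    (tendsto_boundedPERCount_div_bell r)
  intro n h R hR hQ
  rw [mem_perFinset]
  refine ⟨hR, by simp, Or.inl trivial, fun x hx => ?_⟩
  by_contra hlt
  refine hQ ⟨x, isCluster_componentFrame (F := ⟨Fin n, h, R⟩) hR hx, ?_⟩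
  rw [component_eq_of_rel (F := ⟨Fin n, h, R⟩) hR hx]
  have he : {y | R x y} = ((Finset.univ.filter (R x) : Finset (Fin n)) : Set (Fin n)) := by
    ext y; simp
  change (r : ℕ∞) < {y | R x y}.encard
  rw [he, Set.encard_coe_eq_coe_finsetCard]
  have : r < (Finset.univ.filter (R x)).card := by
    refine lt_of_lt_of_le (Nat.lt_succ_self r) (le_of_lt (not_le.1 fun h' => hlt ?_))
    convert h'
  exact_mod_cast this

theorem almostSureLogic_logicK5B : almostSureLogic logicK5B = logicK5B := by
  refine Set.Subset.antisymm (fun φ hφ => ?_) fun φ hφ => ?_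
  · by_contra hne
    obtain ⟨F, hF, hv⟩ := exists_isPER_not_valid hne
    simp only [KripkeFrame.Valid, not_forall] at hv
    obtain ⟨V, a, ha⟩ := hv
    by_cases haa : F.rel a a
    · exact not_holdsAAS_of_subset_compl (holdsAAS_hasClusterLargerThan (2 ^ φ.vars.card))
        (fun G hG => not_valid_of_hasClusterLargerThan hF haa ha hG) hφ
    · exact not_holdsAAS_of_subset_compl holdsAAS_hasIrreflexiveSingleton
        (fun G hG => not_valid_of_hasIrreflexiveSingleton
          (fun b hb => haa (hF.refl_of_rel hb)) ha hG) hφ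
  -- The complement has probability 0 for every `n`, including `n = 0`, where the quotient is `0 / 0
  -- = 0`.
  · refine holdsAAS_of_compl (tendsto_const_nhds.congr fun n => ?_)
    have : labelled n ∩ Fr logicK5B ∩ {F | F.Valid φ}ᶜ = ∅ :=
      Set.eq_empty_of_forall_notMem fun F hF => hF.2 (hF.1.2 φ hφ)
    rw [frameProb, this]
    simp

theorem theorem3p11 :
    almostSureLogic logicK5B = logicK5B ∧
    (∀ F : KripkeFrame.{u}, (F ∈ Fr logicK5B ∧ F.Connected) ↔
      (F.IsCluster ∨ F.IsIrreflexiveSingleton)) ∧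
    (∀ n : ℕ, 1 ≤ n → (KripkeFrame.labelled n ∩ Fr logicK5B).ncard = Nat.bell (n + 1)) ∧
    Tendsto (fun n : ℕ => (Nat.bell n : ℝ) / (Nat.bell (n + 1) : ℝ)) atTop (𝓝 0) ∧
    HoldsAAS (Fr logicK5B) {F | F.HasIrreflexiveSingleton} ∧
    (∀ r : ℕ, HoldsAAS (Fr logicK5B) {F | F.HasClusterLargerThan r}) :=
  ⟨almostSureLogic_logicK5B, mem_Fr_logicK5B_and_connected_iff,
    fun _ hn => ncard_labelled_inter_Fr_logicK5B hn, Nat.tendsto_bell_div_bell_succ,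
    holdsAAS_hasIrreflexiveSingleton, holdsAAS_hasClusterLargerThan⟩
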